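/- Let $n\ge 2$ be an integer and $[n]=\{1,\dots,n\}$. Call a simple graph two-connected if it is connected and remains connected after the removal of any one vertex together with its incident edges (so the single edge on two vertices is two-connected), and let $\mathcal{B}[n]$ be the set of two-connected graphs with vertex set $[n]$. For a graph $G$ on $[n]$ with edge set $E(G)$ let $e(G)=|E(G)|$ and $$\Pi_G=\{(x_2,\dots,x_n)\in\mathbb{R}^{n-1} : |x_i-x_j|<1 \text{ for all } \{i,j\}\in E(G)\},\qquad\text{where } x_1=0.$$ Then $\Pi_G$ has finite volume (Lebesgue measure in $\mathbb{R}^{n-1}$) for every $G\in\mathcal{B}[n]$, and $$\sum_{G\in\mathcal{B}[n]}(-1)^{e(G)}\,\mathrm{Vol}(\Pi_G)=-n\,(n-2)!.$$ -/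

import Mathlib

open MeasureTheory

noncomputable section

namespace TonksGas

/-- A graph is two-connected if it is connected and stays connected whenever a vertex is removed
together with its incident edges. In particular the single edge on two vertices is two-connected. -/
def IsTwoConnected {V : Type*} (G : SimpleGraph V) : Prop :=
  G.Connected ∧ ∀ v : V, (G.induce {v}ᶜ).Connected

open Classical in
/-- The set of two-connected graphs on `n` labelled vertices. -/
def twoConnectedGraphs (n : ℕ) : Finset (SimpleGraph (Fin n)) :=
  Finset.univ.filter fun G => IsTwoConnected G

/-- The vertices other than the first one (which is `0` in `Fin n`); there are `n - 1` of them. -/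
abbrev FreeVertex (n : ℕ) : Type := {i : Fin n // i.val ≠ 0}

/-- The positions of all `n` vertices, when the first one is placed at the origin. -/
def position {n : ℕ} (x : FreeVertex n → ℝ) (i : Fin n) : ℝ :=
  if h : i.val ≠ 0 then x ⟨i, h⟩ else 0

/-- The polytope of `G` in `ℝ^(n-1)`: adjacent vertices are at distance less than `1`,
the first vertex being at the origin. -/
def polytope {n : ℕ} (G : SimpleGraph (Fin n)) : Set (FreeVertex n → ℝ) :=
  {x | ∀ i j : Fin n, G.Adj i j → |position x i - position x j| < 1}

end TonksGas

end

/-! Exchange sum and integral. At a point `x` a graph `G` contributes exactly when it is a subgraph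
of the unit-distance graph `H` of the positions, so the integrand is the signed count of
two-connected spanning subgraphs of `H`. By `twoConnectedSum_eq` this is `-(n-2)!` if `H` is
complete and `0` otherwise. Integrating leaves `-(n-2)!` times the volume of the polytope of the
complete graph, which is `n`: it splits, by the leftmost vertex, into `n` cells of volume `1`.

The count uses that the leftmost point of any subset `A` is simplicial. Let `v` be simplicial and
`u` a neighbour of `v`. Toggling the edge `uv` cancels everything except the graphs that only `uv`
makes two-connected. These are chains of blocks from `u` to `v`, and splitting off the block at `v`,
with cut vertex `w`, factors the count (`twoConnectedSum_eq_sum_lastBlocks`). If `u` and `w` are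
adjacent, toggling `uw` kills the other factor unless the rest is the single edge `uw`. If not, `v`
and `w` are not adjacent either, so the block is no clique and vanishes by induction. What survives
is one copy of the count on `A` without `u` for each neighbour `w ≠ v` of `u`, which yields the
factorial. -/

noncomputable section

namespace TonksGas

/-! ### Connectivity of edge sets through closed vertex sets -/

section Graphs

open scoped Classical

variable {V : Type*}

/-- No edge of `E` leads from `X` to a vertex of `A` outside `X`. -/
def IsClosedIn (E : Finset (Sym2 V)) (A X : Finset V) : Prop :=
  ∀ a ∈ X, ∀ b ∈ A, s(a, b) ∈ E → b ∈ X

/-- The edges `E` connect the vertex set `A` (vacuously so when `A` is empty). -/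
def ConnectedOn (E : Finset (Sym2 V)) (A : Finset V) : Prop :=
  ∀ X ⊆ A, X.Nonempty → IsClosedIn E A X → X = A

/-- The edges `E` connect `A`, and also `A` without any one of its vertices. -/
def TwoConnectedOn (E : Finset (Sym2 V)) (A : Finset V) : Prop :=
  ConnectedOn E A ∧ ∀ c ∈ A, ConnectedOn E (A.erase c)

theorem IsClosedIn.sdiff {E : Finset (Sym2 V)} {A X : Finset V} (h : IsClosedIn E A X) :
    IsClosedIn E A (A \ X) := by
  intro a ha b hb hab
  rw [Finset.mem_sdiff] at ha ⊢
  refine ⟨hb, fun hbX => ha.2 (h b hbX a ha.1 ?_)⟩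
  rwa [Sym2.eq_swap]

/-- To check connectedness it suffices to look at closed sets that avoid a given vertex. -/
theorem connectedOn_iff_avoid {E : Finset (Sym2 V)} {A : Finset V} {w : V} (hw : w ∈ A) :
    ConnectedOn E A ↔ ∀ Y ⊆ A, w ∉ Y → IsClosedIn E A Y → Y = ∅ := by
  constructor
  · intro h Y hY hwY hc
    by_contra hne
    exact hwY (h Y hY (Finset.nonempty_iff_ne_empty.2 hne) hc ▸ hw)
  · intro h X hX hne hc
    by_cases hwX : w ∈ X
    · have := h (A \ X) Finset.sdiff_subset (by simp [hwX]) hc.sdiff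
      exact Finset.Subset.antisymm hX (Finset.sdiff_eq_empty_iff_subset.1 this)
    · exact absurd (h X hX hwX hc) hne.ne_empty

theorem ConnectedOn.mono {E F : Finset (Sym2 V)} {A : Finset V} (h : ConnectedOn E A)
    (hEF : E ⊆ F) : ConnectedOn F A :=
  fun X hX hne hc => h X hX hne fun a ha b hb hab => hc a ha b hb (hEF hab)

theorem TwoConnectedOn.mono {E F : Finset (Sym2 V)} {A : Finset V} (h : TwoConnectedOn E A)
    (hEF : E ⊆ F) : TwoConnectedOn F A :=
  ⟨h.1.mono hEF, fun c hc => (h.2 c hc).mono hEF⟩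

theorem connectedOn_congr {E F : Finset (Sym2 V)} {A : Finset V}
    (h : ∀ a ∈ A, ∀ b ∈ A, s(a, b) ∈ E ↔ s(a, b) ∈ F) : ConnectedOn E A ↔ ConnectedOn F A := by
  have key : ∀ X ⊆ A, IsClosedIn E A X ↔ IsClosedIn F A X := fun X hX =>
    forall₂_congr fun a ha => forall₂_congr fun b hb => by rw [h a (hX ha) b hb]
  exact forall₂_congr fun X hX => by rw [key X hX]

theorem twoConnectedOn_congr {E F : Finset (Sym2 V)} {A : Finset V}
    (h : ∀ a ∈ A, ∀ b ∈ A, s(a, b) ∈ E ↔ s(a, b) ∈ F) :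
    TwoConnectedOn E A ↔ TwoConnectedOn F A :=
  and_congr (connectedOn_congr h) <| forall₂_congr fun _ _ => connectedOn_congr fun a ha b hb =>
    h a (Finset.mem_of_mem_erase ha) b (Finset.mem_of_mem_erase hb)

/-- An edge of a two-connected graph on at least three vertices is not a bridge. -/
theorem connectedOn_of_insert {E : Finset (Sym2 V)} {A : Finset V} {u v : V} (hu : u ∈ A)
    (hv : v ∈ A) (hcard : 3 ≤ A.card) (h : TwoConnectedOn (insert s(u, v) E) A) :
    ConnectedOn E A := by
  rw [connectedOn_iff_avoid hu]
  intro Y hYA huY hc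
  have h1 := h.2 v hv
  have h2 := h.2 u hu
  by_cases hvY : v ∈ Y
  · exfalso
    by_cases huv : u = v
    · exact huY (huv ▸ hvY)
    -- Deleting an end of `uv` makes that edge irrelevant. Deleting `v` forces `Y = {v}`, deleting
    -- `u` forces `Y = A \ {u}`; so `A` would have only two vertices.
    have e1 : Y.erase v = ∅ := by
      refine (connectedOn_iff_avoid (w := u) (by simp [hu, huv])).1 h1 _ ?_ ?_ ?_
      · exact Finset.erase_subset_erase _ hYA
      · simp [huY]
      · intro a ha b hb hab
        simp only [Finset.mem_insert, Sym2.eq_iff, Finset.mem_erase] at *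
        have := hc a ha.2 b hb.2
        grind
    have e2 : Y = A.erase u := by
      refine h2 Y ?_ ⟨v, hvY⟩ ?_
      · intro y hy
        simp only [Finset.mem_erase]
        exact ⟨fun h => huY (h ▸ hy), hYA hy⟩
      · intro a ha b hb hab
        simp only [Finset.mem_insert, Sym2.eq_iff, Finset.mem_erase] at *
        have := hc a ha b hb.2
        grind
    have c1 := Finset.card_erase_of_mem hvY
    have c2 := Finset.card_erase_of_mem hu
    rw [e1] at c1
    rw [← e2] at c2
    simp only [Finset.card_empty] at c1
    omega
  · refine (connectedOn_iff_avoid hu).1 h.1 Y hYA huY ?_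
    intro a ha b hb hab
    simp only [Finset.mem_insert, Sym2.eq_iff] at *
    have := hc a ha b hb
    grind

/-! ### The last block of a chain of blocks -/

/-- `X` together with the cut vertex `w` is the last block, at `v`, of a chain of blocks from `u`
to `v` formed by the edges `E` on `A`. -/
structure IsLastBlock (E : Finset (Sym2 V)) (A : Finset V) (u v w : V) (X : Finset V) : Prop where
  subset : X ⊆ A
  cut_mem : w ∈ A
  cut_notMem : w ∉ X
  mem : v ∈ X
  notMem : u ∉ X
  ne_cut : u ≠ w
  closed : IsClosedIn E (A.erase w) X
  block : TwoConnectedOn E (insert w X)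
  rest_connected : ConnectedOn E (A \ X)
  rest : TwoConnectedOn (insert s(u, w) E) (A \ X)

theorem IsLastBlock.not_twoConnectedOn {E : Finset (Sym2 V)} {A X : Finset V} {u v w : V}
    (hu : u ∈ A) (h : IsLastBlock E A u v w X) : ¬ TwoConnectedOn E A := by
  intro ht
  have hX : X ⊆ A.erase w := fun x hx => Finset.mem_erase.2
    ⟨fun e => h.cut_notMem (e ▸ hx), h.subset hx⟩
  have := ht.2 w h.cut_mem X hX ⟨v, h.mem⟩ h.closed
  exact h.notMem (this ▸ Finset.mem_erase.2 ⟨h.ne_cut, hu⟩)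

/-- The second block stays connected without `w` and contains `v`, so it cannot leave the closed set
`X`. -/
theorem IsLastBlock.subset_of {E : Finset (Sym2 V)} {A X X' : Finset V} {u v w w' : V}
    (h : IsLastBlock E A u v w X) (h' : IsLastBlock E A u v w' X') :
    insert w' X' ⊆ insert w X := by
  have hvw : v ≠ w := fun e => h.cut_notMem (e ▸ h.mem)
  have hconn : ConnectedOn E ((insert w' X').erase w) := by
    by_cases hw : w ∈ insert w' X'
    · exact h'.block.2 w hw
    · rw [Finset.erase_eq_of_notMem hw]
      exact h'.block.1
  have hsub : (insert w' X').erase w ⊆ A.erase w := Finset.erase_subset_erase _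
    (Finset.insert_subset h'.cut_mem h'.subset)
  have := hconn (X ∩ (insert w' X').erase w) Finset.inter_subset_right
    ⟨v, by simp [h.mem, h'.mem, hvw]⟩ (fun a ha b hb hab => Finset.mem_inter.2
      ⟨h.closed a (Finset.mem_inter.1 ha).1 b (hsub hb) hab, hb⟩)
  intro x hx
  by_cases hxw : x = w
  · simp [hxw]
  · have : x ∈ X ∩ (insert w' X').erase w := by rw [this]; simp [hxw]; simpa using hx
    exact Finset.mem_insert_of_mem (Finset.mem_inter.1 this).1

/-- The blocks agree by `IsLastBlock.subset_of`. If the cut vertices differed, `w` would lie in `X'`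
and have no edge leaving the block; the connected rest would then be `{w}`, yet it contains `u`. -/
theorem IsLastBlock.unique {E : Finset (Sym2 V)} {A X X' : Finset V} {u v w w' : V} (hu : u ∈ A)
    (h : IsLastBlock E A u v w X) (h' : IsLastBlock E A u v w' X') : w = w' ∧ X = X' := by
  have hB : insert w X = insert w' X' :=
    Finset.Subset.antisymm (h'.subset_of h) (h.subset_of h')
  have hw : w = w' := by
    by_contra hne
    have hwX' : w ∈ X' := by
      have : w ∈ insert w' X' := hB ▸ Finset.mem_insert_self _ _
      exact (Finset.mem_insert.1 this).resolve_left hne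
    have : ({w} : Finset V) = A \ X := by
      refine h.rest_connected _ ?_ (by simp) ?_
      · simp [h.cut_mem, h.cut_notMem]
      · intro a ha b hb hab
        rw [Finset.mem_singleton] at ha
        subst ha
        by_contra hbw
        rw [Finset.mem_sdiff] at hb
        rw [Finset.mem_singleton] at hbw
        have hbB : b ∉ insert w' X' := hB ▸ by simp [hbw, hb.2]
        simp only [Finset.mem_insert, not_or] at hbB
        exact hbB.2 (h'.closed a hwX' b (by simp [hb.1, hbB.1]) hab)
    have : u ∈ ({w} : Finset V) := this ▸ by simp [hu, h.notMem]
    exact h.ne_cut (by simpa using this)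
  subst hw
  refine ⟨rfl, ?_⟩
  rw [← Finset.erase_insert h.cut_notMem, hB, Finset.erase_insert h'.cut_notMem]

/-- The edge `uv` closes the chain to a ring. For the rest, the detour from `u` over `v` through the
block to `w` replaces the auxiliary edge `uw`. -/
theorem IsLastBlock.twoConnectedOn_insert {E : Finset (Sym2 V)} {A X : Finset V} {u v w : V}
    (hu : u ∈ A) (h : IsLastBlock E A u v w X) : TwoConnectedOn (insert s(u, v) E) A := by
  have hcl := h.closed
  have hXA := h.subset
  have hwA := h.cut_mem
  have hwX := h.cut_notMem
  have hv := h.mem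
  have huX := h.notMem
  have huw := h.ne_cut
  have hwB : w ∈ insert w X := Finset.mem_insert_self _ _
  have hwR : w ∈ A \ X := by simp [hwA, hwX]
  have restE : ∀ {F : Finset (Sym2 V)} {C Y : Finset V} (D : Finset V), D ⊆ C → E ⊆ F →
      IsClosedIn F C Y → IsClosedIn E D (Y ∩ D) := by
    intro F C Y D hD hEF hY a ha b hb hab
    rw [Finset.mem_inter] at ha ⊢
    exact ⟨hY a ha.1 b (hD hb) (hEF hab), hb⟩
  have hEF : E ⊆ insert s(u, v) E := Finset.subset_insert _ _
  refine ⟨?_, fun c hc => ?_⟩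
  · rw [connectedOn_iff_avoid hwA]
    intro Y hY hwY hYc
    have e1 := (connectedOn_iff_avoid hwB).1 h.block.1 (Y ∩ insert w X) Finset.inter_subset_right
      (by simp [hwY]) (restE _ (by grind) hEF hYc)
    have e2 := (connectedOn_iff_avoid hwR).1 h.rest_connected (Y ∩ (A \ X))
      Finset.inter_subset_right (by simp [hwY]) (restE _ (by grind) hEF hYc)
    grind
  by_cases hcw : c = w
  · subst hcw
    have hvA : v ∈ A.erase c := by grind
    rw [connectedOn_iff_avoid hvA]
    intro Y hY hvY hYc
    have b1 := h.block.2 c hwB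
    rw [Finset.erase_insert hwX] at b1
    have e1 := (connectedOn_iff_avoid hv).1 b1 (Y ∩ X) Finset.inter_subset_right
      (by simp [hvY]) (restE _ (by grind) hEF hYc)
    have huY : u ∉ Y := fun huY => hvY (hYc u huY v hvA (by simp))
    have huR : u ∈ (A \ X).erase c := by grind
    have e2 := (connectedOn_iff_avoid huR).1 (h.rest.2 c hwR) (Y ∩ (A \ X).erase c)
      Finset.inter_subset_right (by simp [huY]) (by
        intro a ha b hb hab
        have : s(a, b) ∈ E := by
          simp only [Finset.mem_insert, Sym2.eq_iff] at hab
          grind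
        have := hYc a (by grind) b (by grind) (hEF this)
        grind)
    grind
  have hwC : w ∈ A.erase c := by grind
  rw [connectedOn_iff_avoid hwC]
  intro Y hY hwY hYc
  by_cases hcX : c ∈ X
  · have hwBc : w ∈ (insert w X).erase c := by grind
    have e1 := (connectedOn_iff_avoid hwBc).1 (h.block.2 c (by grind))
      (Y ∩ (insert w X).erase c) Finset.inter_subset_right
      (by simp [hwY]) (restE _ (by grind) hEF hYc)
    have e2 := (connectedOn_iff_avoid hwR).1 h.rest_connected (Y ∩ (A \ X))
      Finset.inter_subset_right (by simp [hwY]) (restE _ (by grind) hEF hYc)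
    grind
  -- The block is intact, so `Y` misses `v` and hence `u`; therefore the edge `uw` does not leave
  -- `Y` either.
  · have e1 := (connectedOn_iff_avoid hwB).1 h.block.1 (Y ∩ insert w X)
      Finset.inter_subset_right (by simp [hwY]) (restE _ (by grind) hEF hYc)
    have hvY : v ∉ Y := fun hvY => by
      have : v ∈ Y ∩ insert w X := by simp [hvY, hv]
      simp [e1] at this
    have huY : u ∉ Y := fun huY => hvY (hYc u huY v (by grind) (by simp))
    have hwRc : w ∈ (A \ X).erase c := by grind
    have e2 := (connectedOn_iff_avoid hwRc).1 (h.rest.2 c (by grind)) (Y ∩ (A \ X).erase c)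
      Finset.inter_subset_right (by simp [hwY]) (by
        intro a ha b hb hab
        have : s(a, b) ∈ E := by
          simp only [Finset.mem_insert, Sym2.eq_iff] at hab
          grind
        have := hYc a (by grind) b (by grind) (hEF this)
        grind)
    grind

theorem exists_isLastBlock {E : Finset (Sym2 V)} {A : Finset V} {u v : V} (hu : u ∈ A)
    (hv : v ∈ A) (hcard : 3 ≤ A.card) (hins : TwoConnectedOn (insert s(u, v) E) A)
    (hnot : ¬ TwoConnectedOn E A) : ∃ w X, IsLastBlock E A u v w X := by
  have hconn := connectedOn_of_insert hu hv hcard hins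
  have hex : ∃ X : Finset V, ∃ w ∈ A, X ⊆ A.erase w ∧ v ∈ X ∧ u ∉ X ∧ u ≠ w ∧
      IsClosedIn E (A.erase w) X := by
    have : ∃ w ∈ A, ¬ ConnectedOn E (A.erase w) := by
      by_contra! hall
      exact hnot ⟨hconn, hall⟩
    obtain ⟨w, hw, hnc⟩ := this
    have hcw := hins.2 w hw
    unfold ConnectedOn at hnc
    push Not at hnc
    obtain ⟨X, hX, hne, hXc, hXA⟩ := hnc
    have hncl : ¬ IsClosedIn (insert s(u, v) E) (A.erase w) X := fun h => hXA (hcw X hX hne h)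
    unfold IsClosedIn at hncl
    push Not at hncl
    obtain ⟨a, ha, b, hb, hab, hbX⟩ := hncl
    have hab' : s(a, b) = s(u, v) := by
      rcases Finset.mem_insert.1 hab with h | h
      · exact h
      · exact absurd (hXc a ha b hb h) hbX
    rw [Sym2.eq_iff] at hab'
    rcases hab' with ⟨rfl, rfl⟩ | ⟨rfl, rfl⟩
    · exact ⟨A.erase w \ X, w, hw, Finset.sdiff_subset, by grind, by grind, by grind,
        hXc.sdiff⟩
    · exact ⟨X, w, hw, hX, ha, hbX, by grind, hXc⟩
  -- The smallest set separated from `u` around `v`, over all cut vertices, belongs to the last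
  -- block.
  obtain ⟨X, hXmin⟩ := exists_minimalFor_of_wellFoundedLT _ Finset.card hex
  obtain ⟨⟨w, hwA, hXw, hvX, huX, huw, hXc⟩, hmin⟩ := hXmin
  have hEF : E ⊆ insert s(u, v) E := Finset.subset_insert _ _
  have hwX : w ∉ X := by grind
  have hwR : w ∈ A \ X := by grind
  have hRconn : ConnectedOn E (A \ X) := by
    rw [connectedOn_iff_avoid hwR]
    intro Y hY hwY hYc
    refine (connectedOn_iff_avoid hwA).1 hconn Y (by grind) hwY ?_
    intro a ha b hb hab
    by_cases hbX : b ∈ X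
    · have := hXc b hbX a (by grind) (by rwa [Sym2.eq_swap])
      grind
    · exact hYc a ha b (by grind) hab
  refine ⟨w, X, by grind, hwA, hwX, hvX, huX, huw, hXc, ⟨?_, ?_⟩, hRconn, ⟨?_, ?_⟩⟩
  · rw [connectedOn_iff_avoid (Finset.mem_insert_self w X)]
    intro Y hY hwY hYc
    refine (connectedOn_iff_avoid hwA).1 hconn Y (by grind) hwY ?_
    intro a ha b hb hab
    by_cases hbw : b = w
    · exact hYc a ha b (by simp [hbw]) hab
    · exact hYc a ha b (Finset.mem_insert_of_mem (hXc a (by grind) b (by grind) hab)) hab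
  · intro c hc
    by_cases hcw : c = w
    · subst hcw
      rw [Finset.erase_insert hwX]
      have hmin' : ∀ Y ⊆ X, v ∈ Y → IsClosedIn E X Y → X ⊆ Y := by
        intro Y hY hvY hYc
        have := hmin (j := Y) ⟨c, hwA, by grind, hvY, by grind, huw, fun a ha b hb hab =>
          hYc a ha b (hXc a (hY ha) b hb hab) hab⟩ (Finset.card_le_card hY)
        exact (Finset.eq_of_subset_of_card_le hY this).symm.subset
      rw [connectedOn_iff_avoid hvX]
      intro Y hY hvY hYc
      have := hmin' (X \ Y) Finset.sdiff_subset (by grind) hYc.sdiff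
      grind
    · have hcX : c ∈ X := by grind
      have hwc : w ∈ (insert w X).erase c := by grind
      rw [connectedOn_iff_avoid hwc]
      intro Y hY hwY hYc
      have hYX : Y ⊆ X.erase c := by grind
      have hclE : IsClosedIn E (A.erase c) Y := by
        intro a ha b hb hab
        by_cases hbw : b = w
        · exact hYc a ha b (by grind) hab
        · have := hXc a (by grind) b (by grind) hab
          exact hYc a ha b (by grind) hab
      -- If `v ∈ Y`, then `c` is a cut vertex with the smaller separated set `Y`, against
      -- minimality.
      by_cases hvY : v ∈ Y
      · have h1 : Y.card ≤ (X.erase c).card := Finset.card_le_card hYX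
        have h2 := Finset.card_erase_lt_of_mem hcX
        have := hmin (j := Y) ⟨c, by grind, by grind, hvY, by grind, by grind, hclE⟩ (by omega)
        omega
      · have hwAc : w ∈ A.erase c := by grind
        refine (connectedOn_iff_avoid hwAc).1 (hins.2 c (by grind)) Y (by grind) hwY ?_
        intro a ha b hb hab
        have : s(a, b) ∈ E := by
          simp only [Finset.mem_insert, Sym2.eq_iff] at hab
          grind
        exact hclE a ha b hb this
  · exact hRconn.mono (Finset.subset_insert _ _)
  · intro c hc
    -- Edges between `X` and the rest all end at `w`, so a closed set of the rest avoiding `u` and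
    -- `w` stays closed in `A`.
    have hlift : ∀ Y ⊆ (A \ X).erase c, u ∉ Y → (c = w ∨ w ∉ Y) →
        IsClosedIn (insert s(u, w) E) ((A \ X).erase c) Y →
        IsClosedIn (insert s(u, v) E) (A.erase c) Y := by
      intro Y hY huY hcw hYc a ha b hb hab
      have haX : a ∉ X := by grind
      have hE : s(a, b) ∈ E := by
        simp only [Finset.mem_insert, Sym2.eq_iff] at hab
        grind
      have hbX : b ∉ X := fun hbX => haX
        (hXc b hbX a (by grind) (by rwa [Sym2.eq_swap]))
      exact hYc a ha b (by grind) (Finset.mem_insert_of_mem hE)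
    by_cases hcw : c = w
    · have huR : u ∈ (A \ X).erase c := by grind
      rw [connectedOn_iff_avoid huR]
      intro Y hY huY hYc
      have huA : u ∈ A.erase c := by grind
      exact (connectedOn_iff_avoid huA).1 (hins.2 c (by grind)) Y (by grind) huY
        (hlift Y hY huY (Or.inl hcw) hYc)
    · have hwR' : w ∈ (A \ X).erase c := by grind
      rw [connectedOn_iff_avoid hwR']
      intro Y hY hwY hYc
      have huY : u ∉ Y := fun huY => hwY (hYc u huY w hwR' (by simp))
      have hwA' : w ∈ A.erase c := by grind
      exact (connectedOn_iff_avoid hwA').1 (hins.2 c (by grind)) Y (by grind) hwY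
        (hlift Y hY huY (Or.inr hwY) hYc)

/-! ### Signed counts of subgraphs and their factorization -/

/-- The edges of `H` with both ends in `A`. -/
def edgesOn (H : SimpleGraph V) (A : Finset V) : Finset (Sym2 V) :=
  A.sym2.filter (· ∈ H.edgeSet)

theorem mk_mem_edgesOn {H : SimpleGraph V} {A : Finset V} {a b : V} :
    s(a, b) ∈ edgesOn H A ↔ (a ∈ A ∧ b ∈ A) ∧ H.Adj a b := by
  simp [edgesOn]

/-- The signed count of the two-connected subgraphs of `H` with vertex set `A`. -/
def twoConnectedSum (H : SimpleGraph V) (A : Finset V) : ℤ :=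
  ∑ E ∈ (edgesOn H A).powerset, if TwoConnectedOn E A then (-1) ^ E.card else 0

/-- The signed count of the connected subgraphs of `H` with vertex set `A` that the edge between
`u` and `w` makes two-connected. -/
def chainSum (H : SimpleGraph V) (A : Finset V) (u w : V) : ℤ :=
  ∑ E ∈ (edgesOn H A).powerset,
    if ConnectedOn E A ∧ TwoConnectedOn (insert s(u, w) E) A then (-1) ^ E.card else 0

theorem sum_powerset_erase {α M : Type*} [DecidableEq α] [AddCommMonoid M] {S : Finset α} {e : α}
    (he : e ∈ S) (g : Finset α → M) :
    ∑ E ∈ S.powerset, g E = ∑ E ∈ (S.erase e).powerset, (g E + g (insert e E)) := by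
  rw [Finset.sum_add_distrib, ← Finset.sum_powerset_insert (Finset.notMem_erase e S),
    Finset.insert_erase he]

theorem sum_powerset_union {α M : Type*} [DecidableEq α] [AddCommMonoid M] {S T : Finset α}
    (h : Disjoint S T) (g : Finset α → M) :
    ∑ E ∈ (S ∪ T).powerset, g E = ∑ F ∈ S.powerset, ∑ G ∈ T.powerset, g (F ∪ G) := by
  rw [← Finset.sum_product']
  refine Finset.sum_nbij' (fun E => (E ∩ S, E ∩ T)) (fun p => p.1 ∪ p.2) ?_ ?_ ?_ ?_ ?_
  · intro E _
    simp [Finset.inter_subset_right]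
  · rintro ⟨F, G⟩ hp
    simp only [Finset.mem_product, Finset.mem_powerset] at hp ⊢
    exact Finset.union_subset_union hp.1 hp.2
  · intro E hE
    rw [Finset.mem_powerset] at hE
    simp only [← Finset.inter_union_distrib_left]
    exact Finset.inter_eq_left.2 hE
  · rintro ⟨F, G⟩ hp
    simp only [Finset.mem_product, Finset.mem_powerset] at hp
    have h1 : G ∩ S = ∅ := (h.symm.mono_left hp.2).eq_bot
    have h2 : F ∩ T = ∅ := (h.mono_left hp.1).eq_bot
    simp [Finset.union_inter_distrib_right, h1, h2, hp.1, hp.2]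
  · intro E hE
    rw [Finset.mem_powerset] at hE
    simp only [← Finset.inter_union_distrib_left]
    rw [Finset.inter_eq_left.2 hE]

/-- Toggling `uw` flips the sign and preserves the condition, as `uw` is not a bridge by
`connectedOn_of_insert`. -/
theorem chainSum_eq_zero {H : SimpleGraph V} {A : Finset V} {u w : V} (hu : u ∈ A) (hw : w ∈ A)
    (huw : H.Adj u w) (hcard : 3 ≤ A.card) : chainSum H A u w = 0 := by
  have he : s(u, w) ∈ edgesOn H A := mk_mem_edgesOn.2 ⟨⟨hu, hw⟩, huw⟩
  rw [chainSum, sum_powerset_erase he]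
  refine Finset.sum_eq_zero fun E hE => ?_
  have hnot : s(u, w) ∉ E := fun h => Finset.notMem_erase _ _ (Finset.mem_powerset.1 hE h)
  rw [Finset.insert_idem, Finset.card_insert_of_notMem hnot]
  by_cases h : TwoConnectedOn (insert s(u, w) E) A
  · have h1 := connectedOn_of_insert hu hw hcard h
    rw [if_pos ⟨h1, h⟩, if_pos ⟨h.1, h⟩]
    ring
  · simp [h]

theorem edgesOn_pair {H : SimpleGraph V} {u w : V} (h : H.Adj u w) :
    edgesOn H {u, w} = {s(u, w)} := by
  ext e
  induction e with
  | _ a b =>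
    have := h.ne
    rw [mk_mem_edgesOn]
    simp only [Finset.mem_insert, Finset.mem_singleton, Sym2.eq_iff]
    constructor
    · rintro ⟨⟨rfl | rfl, rfl | rfl⟩, hab⟩ <;> simp_all
    · rintro (⟨rfl, rfl⟩ | ⟨rfl, rfl⟩)
      · simp [h]
      · simp [h.symm]

theorem not_connectedOn_pair {u w : V} (h : u ≠ w) : ¬ ConnectedOn ∅ {u, w} := by
  intro hc
  have := hc {u} (by simp) (by simp) (fun a _ b _ hab => by simp at hab)
  have hw : w ∈ ({u} : Finset V) := by rw [this]; simp
  exact h (Finset.mem_singleton.1 hw).symm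

theorem twoConnectedOn_pair {u w : V} (h : u ≠ w) : TwoConnectedOn {s(u, w)} {u, w} := by
  constructor
  · rw [connectedOn_iff_avoid (w := u) (by simp)]
    intro Y hY huY hYc
    rw [Finset.eq_empty_iff_forall_notMem]
    intro y hy
    have : y = w := by
      have := hY hy
      simp only [Finset.mem_insert, Finset.mem_singleton] at this
      rcases this with rfl | rfl
      · exact absurd hy huY
      · rfl
    subst this
    exact huY (hYc y hy u (by simp) (by simp [Sym2.eq_swap]))
  · intro c hc X hX hne _
    refine Finset.Subset.antisymm hX ?_
    obtain ⟨x, hx⟩ := hne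
    have := hX hx
    intro y hy
    have : x = y := by
      simp only [Finset.mem_erase, Finset.mem_insert, Finset.mem_singleton] at *
      grind
    exact this ▸ hx

theorem chainSum_pair {H : SimpleGraph V} {u w : V} (h : H.Adj u w) :
    chainSum H {u, w} u w = -1 := by
  rw [chainSum, edgesOn_pair h, sum_powerset_erase (Finset.mem_singleton_self _)]
  have h2 := twoConnectedOn_pair h.ne
  simp [not_connectedOn_pair h.ne, h2, h2.1]

theorem twoConnectedSum_pair {H : SimpleGraph V} {u w : V} (h : H.Adj u w) :
    twoConnectedSum H {u, w} = -1 := by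
  rw [twoConnectedSum, edgesOn_pair h, sum_powerset_erase (Finset.mem_singleton_self _)]
  have h2 := twoConnectedOn_pair h.ne
  have h3 : ¬ TwoConnectedOn ∅ {u, w} := fun h' => not_connectedOn_pair h.ne h'.1
  simp [h3, h2]

/-- The pairs of a cut vertex and a last block without its cut vertex that are conceivable for a
chain of blocks from `u` to `v` on `A`. -/
def lastBlocks (A : Finset V) (u v : V) : Finset (V × Finset V) :=
  (A ×ˢ A.powerset).filter fun p => p.1 ∉ p.2 ∧ v ∈ p.2 ∧ u ∉ p.2 ∧ u ≠ p.1

theorem IsLastBlock.mem_lastBlocks {E : Finset (Sym2 V)} {A X : Finset V} {u v w : V}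
    (h : IsLastBlock E A u v w X) : (w, X) ∈ lastBlocks A u v := by
  simp only [lastBlocks, Finset.mem_filter, Finset.mem_product, Finset.mem_powerset]
  exact ⟨⟨h.cut_mem, h.subset⟩, h.cut_notMem, h.mem, h.notMem, h.ne_cut⟩

/-- Block and rest share only `w`, so their edge sets are disjoint; closedness of `X` puts every
edge into one of them. Neither contains `uv`. -/
theorem sum_isLastBlock {H : SimpleGraph V} {A X : Finset V} {u v w : V}
    (hp : (w, X) ∈ lastBlocks A u v) :
    ∑ E ∈ ((edgesOn H A).erase s(u, v)).powerset,
      (if IsLastBlock E A u v w X then (-1 : ℤ) ^ E.card else 0) =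
    twoConnectedSum H (insert w X) * chainSum H (A \ X) u w := by
  simp only [lastBlocks, Finset.mem_filter, Finset.mem_product, Finset.mem_powerset] at hp
  obtain ⟨⟨hwA, hXA⟩, hwX, hvX, huX, huw⟩ := hp
  have hdisj : Disjoint (edgesOn H (insert w X)) (edgesOn H (A \ X)) := by
    rw [Finset.disjoint_left]
    intro e
    induction e with
    | _ a b =>
      rw [mk_mem_edgesOn, mk_mem_edgesOn]
      rintro ⟨⟨ha, hb⟩, hab⟩ ⟨⟨ha', hb'⟩, -⟩
      have := hab.ne
      grind
  have hsub : edgesOn H (insert w X) ∪ edgesOn H (A \ X) ⊆ (edgesOn H A).erase s(u, v) := by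
    intro e
    induction e with
    | _ a b =>
      simp only [Finset.mem_union, Finset.mem_erase, mk_mem_edgesOn, ne_eq, Sym2.eq_iff]
      grind
  rw [← Finset.sum_subset (Finset.powerset_mono.2 hsub), sum_powerset_union hdisj,
    twoConnectedSum, chainSum, Finset.sum_mul_sum]
  · refine Finset.sum_congr rfl fun F hF => Finset.sum_congr rfl fun G hG => ?_
    rw [Finset.mem_powerset] at hF hG
    rw [Finset.card_union_of_disjoint (Finset.disjoint_of_subset_left hF
      (Finset.disjoint_of_subset_right hG hdisj)), pow_add]
    have hB : ∀ a ∈ insert w X, ∀ b ∈ insert w X, s(a, b) ∈ F ∪ G ↔ s(a, b) ∈ F := by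
      intro a ha b hb
      rw [Finset.mem_union, or_iff_left_iff_imp]
      intro hab
      have := mk_mem_edgesOn.1 (hG hab)
      have := this.2.ne
      grind
    have hR : ∀ a ∈ A \ X, ∀ b ∈ A \ X, s(a, b) ∈ F ∪ G ↔ s(a, b) ∈ G := by
      intro a ha b hb
      rw [Finset.mem_union, or_iff_right_iff_imp]
      intro hab
      have := mk_mem_edgesOn.1 (hF hab)
      have := this.2.ne
      grind
    have hR' : ∀ a ∈ A \ X, ∀ b ∈ A \ X,
        s(a, b) ∈ insert s(u, w) (F ∪ G) ↔ s(a, b) ∈ insert s(u, w) G := by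
      intro a ha b hb
      rw [Finset.mem_insert, Finset.mem_insert, hR a ha b hb]
    have hiff : IsLastBlock (F ∪ G) A u v w X ↔ TwoConnectedOn F (insert w X) ∧
        ConnectedOn G (A \ X) ∧ TwoConnectedOn (insert s(u, w) G) (A \ X) := by
      rw [← twoConnectedOn_congr hB, ← connectedOn_congr hR, ← twoConnectedOn_congr hR']
      refine ⟨fun h => ⟨h.block, h.rest_connected, h.rest⟩, fun h =>
        ⟨hXA, hwA, hwX, hvX, huX, huw, ?_, h.1, h.2.1, h.2.2⟩⟩
      intro a ha b hb hab
      rcases Finset.mem_union.1 hab with hab | hab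
      · have := mk_mem_edgesOn.1 (hF hab)
        grind
      · have := mk_mem_edgesOn.1 (hG hab)
        grind
    by_cases h1 : TwoConnectedOn F (insert w X) <;>
      by_cases h2 : ConnectedOn G (A \ X) ∧ TwoConnectedOn (insert s(u, w) G) (A \ X)
    · rw [if_pos (hiff.2 ⟨h1, h2⟩), if_pos h1, if_pos h2]
    · rw [if_neg (fun h => h2 (hiff.1 h).2), if_neg h2, mul_zero]
    · rw [if_neg (fun h => h1 (hiff.1 h).1), if_neg h1, zero_mul]
    · rw [if_neg (fun h => h1 (hiff.1 h).1), if_neg h1, zero_mul]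
  · intro E hE hE'
    rw [if_neg]
    intro h
    apply hE'
    rw [Finset.mem_powerset] at hE ⊢
    intro e he
    have heA := Finset.mem_of_mem_erase (hE he)
    induction e with
    | _ a b =>
      rw [mk_mem_edgesOn] at heA
      have h1 := fun ha hb => h.closed a ha b hb he
      have h2 := fun hb ha => h.closed b hb a ha (by rwa [Sym2.eq_swap])
      simp only [Finset.mem_union, mk_mem_edgesOn]
      grind

/-- Pairing `E` with `E ∪ {uv}` leaves minus the sum over those `E` that only `uv` makes
two-connected; each has exactly one last block. -/
theorem twoConnectedSum_eq_sum_lastBlocks {H : SimpleGraph V} {A : Finset V} {u v : V}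
    (hu : u ∈ A) (hv : v ∈ A) (huv : H.Adj u v) (hcard : 3 ≤ A.card) :
    twoConnectedSum H A = -∑ p ∈ lastBlocks A u v,
      twoConnectedSum H (insert p.1 p.2) * chainSum H (A \ p.2) u p.1 := by
  have he : s(u, v) ∈ edgesOn H A := mk_mem_edgesOn.2 ⟨⟨hu, hv⟩, huv⟩
  rw [← Finset.sum_congr rfl fun p hp => sum_isLastBlock (H := H) hp, Finset.sum_comm,
    twoConnectedSum, sum_powerset_erase he, ← Finset.sum_neg_distrib]
  refine Finset.sum_congr rfl fun E hE => ?_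
  have hnot : s(u, v) ∉ E := fun h => Finset.notMem_erase _ _ (Finset.mem_powerset.1 hE h)
  rw [Finset.card_insert_of_notMem hnot]
  by_cases h : ∃ w X, IsLastBlock E A u v w X
  · obtain ⟨w, X, h⟩ := h
    rw [Finset.sum_eq_single_of_mem (w, X) h.mem_lastBlocks, if_pos h,
      if_neg (h.not_twoConnectedOn hu), if_pos (h.twoConnectedOn_insert hu)]
    · ring
    · rintro ⟨w', X'⟩ - hne
      rw [if_neg]
      intro h'
      obtain ⟨rfl, rfl⟩ := h.unique hu h'
      exact hne rfl
  · rw [Finset.sum_eq_zero fun p _ => if_neg fun hp => h ⟨p.1, p.2, hp⟩]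
    by_cases h2 : TwoConnectedOn E A
    · rw [if_pos h2, if_pos (h2.mono (Finset.subset_insert _ _))]
      ring
    · rw [if_neg h2, if_neg fun h3 => h (exists_isLastBlock hu hv hcard h3 h2)]
      simp

/-! ### The signed count in graphs with simplicial vertices -/

/-- Every nonempty set of vertices contains one whose neighbours in the set form a clique. -/
def HasSimplicialVertices (H : SimpleGraph V) : Prop :=
  ∀ A : Finset V, A.Nonempty → ∃ v ∈ A, ∀ a ∈ A, ∀ b ∈ A, H.Adj v a → H.Adj v b → a ≠ b → H.Adj a b

theorem twoConnectedSum_eq {H : SimpleGraph V} (hH : HasSimplicialVertices H) (A : Finset V)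
    (hA : 2 ≤ A.card) :
    twoConnectedSum H A = if H.IsClique A then -((A.card - 2).factorial : ℤ) else 0 := by
  induction hn : A.card using Nat.strong_induction_on generalizing A with
  | _ n ih =>
  subst hn
  obtain ⟨v, hv, hsimp⟩ := hH A (Finset.card_pos.1 (by omega))
  by_cases hex : ∃ u ∈ A, H.Adj v u
  swap
  · push Not at hex
    obtain ⟨a, ha, hav⟩ := Finset.exists_mem_ne (by omega : 1 < A.card) v
    rw [if_neg fun hcl => hex a ha (hcl hv ha hav.symm)]
    refine Finset.sum_eq_zero fun E hE => if_neg fun h => ?_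
    have : ({v} : Finset V) = A := by
      refine h.1 _ (by simpa using hv) (by simp) ?_
      intro x hx b hb hxb
      rw [Finset.mem_singleton] at hx
      subst hx
      exact absurd (mk_mem_edgesOn.1 (Finset.mem_powerset.1 hE hxb)).2 (hex b hb)
    rw [← this, Finset.mem_singleton] at ha
    exact hav ha
  obtain ⟨u, hu, hvu⟩ := hex
  rcases hA.eq_or_lt with h2 | h3
  · have hAe : A = {u, v} := by
      symm
      apply Finset.eq_of_subset_of_card_le
      · intro x hx
        simp only [Finset.mem_insert, Finset.mem_singleton] at hx
        rcases hx with rfl | rfl <;> assumption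
      · rw [Finset.card_pair hvu.ne', ← h2]
    rw [if_pos, hAe, twoConnectedSum_pair hvu.symm, Finset.card_pair hvu.ne']
    · simp
    · rw [hAe]
      simp [SimpleGraph.isClique_insert, hvu.symm]
  have hdom : ∀ w ∈ A, H.Adj v w → u ≠ w → H.Adj u w := fun w hw hvw huw =>
    hsimp u hu w hw hvu hvw huw
  have key : twoConnectedSum H A =
      ∑ w ∈ A.filter (fun w => w ≠ v ∧ H.Adj u w), twoConnectedSum H (A.erase u) := by
    rw [twoConnectedSum_eq_sum_lastBlocks hu hv hvu.symm h3, ← Finset.sum_neg_distrib]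
    symm
    refine Finset.sum_of_injOn (fun w => (w, A \ {u, w})) ?_ ?_ ?_ ?_
    · intro w _ w' _ h
      exact congrArg Prod.fst h
    · intro w hw
      simp only [Finset.coe_filter, Set.mem_ofPred_eq] at hw
      have := hw.2.2.ne
      simp only [lastBlocks, Finset.coe_filter, Set.mem_ofPred_eq, Finset.mem_product,
        Finset.mem_powerset]
      have := hvu.ne
      grind
    · rintro ⟨w, X⟩ hp hnot
      have hp' := hp
      simp only [lastBlocks, Finset.mem_filter, Finset.mem_product, Finset.mem_powerset] at hp
      obtain ⟨⟨hwA, hXA⟩, hwX, hvX, huX, huw⟩ := hp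
      have hvw : v ≠ w := fun e => hwX (e ▸ hvX)
      rw [neg_eq_zero, mul_eq_zero]
      by_cases hadj : H.Adj u w
      · right
        refine chainSum_eq_zero (by simp [hu, huX]) (by simp [hwA, hwX]) hadj ?_
        by_contra hlt
        simp only at hlt
        apply hnot
        have hR : {u, w} = A \ X := by
          refine Finset.eq_of_subset_of_card_le ?_ ?_
          · intro x hx
            simp only [Finset.mem_insert, Finset.mem_singleton] at hx
            rcases hx with rfl | rfl <;> simp [*]
          · rw [Finset.card_pair huw]
            omega
        refine ⟨w, by simp [hwA, hvw.symm, hadj], ?_⟩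
        simp only [hR, Finset.sdiff_sdiff_eq_self hXA]
      -- As `v` is simplicial, `v` adjacent to `w` would make `u` adjacent to `w`; so the block is
      -- not a clique.
      · left
        have hlt : (insert w X).card < A.card := by
          apply Finset.card_lt_card
          rw [Finset.ssubset_iff_of_subset (Finset.insert_subset hwA hXA)]
          exact ⟨u, hu, by simp [huX, huw]⟩
        have h2 : 2 ≤ (insert w X).card := by
          rw [Finset.card_insert_of_notMem hwX]
          have := Finset.card_pos.2 ⟨v, hvX⟩
          omega
        rw [ih _ hlt _ h2 rfl, if_neg]
        intro hcl
        exact hadj (hdom w hwA (hcl (by simp [hvX]) (by simp) hvw) huw)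
    · intro w hw
      simp only [Finset.mem_filter] at hw
      have hne := hw.2.2.ne
      have hsub : ({u, w} : Finset V) ⊆ A := by
        intro x hx
        simp only [Finset.mem_insert, Finset.mem_singleton] at hx
        rcases hx with rfl | rfl
        · exact hu
        · exact hw.1
      have e1 : insert w (A \ {u, w}) = A.erase u := by grind
      simp only
      rw [Finset.sdiff_sdiff_eq_self hsub, chainSum_pair hw.2.2, e1]
      ring
  have hc := Finset.card_erase_of_mem hu
  rw [key, Finset.sum_const, ih _ (by omega) (A.erase u) (by omega) rfl, hc]
  by_cases hcl : H.IsClique (A.erase u)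
  · have hu_adj : ∀ w ∈ A, u ≠ w → H.Adj u w := by
      intro w hw huw
      by_cases hvw : v = w
      · exact hvw ▸ hvu.symm
      · exact hdom w hw (hcl (by simp [hv, hvu.ne]) (by simp [hw, huw.symm]) hvw) huw
    have hclA : H.IsClique A := by
      rw [← Finset.insert_erase hu, Finset.coe_insert, SimpleGraph.isClique_insert]
      exact ⟨hcl, fun b hb hub => hu_adj b (Finset.mem_of_mem_erase hb) hub⟩
    have hfil : A.filter (fun w => w ≠ v ∧ H.Adj u w) = (A.erase u).erase v := by
      ext w
      simp only [Finset.mem_filter, Finset.mem_erase]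
      constructor
      · rintro ⟨h1, h2, h3⟩
        exact ⟨h2, h3.ne', h1⟩
      · rintro ⟨h1, h2, h3⟩
        exact ⟨h3, h1, hu_adj w h3 h2.symm⟩
    rw [if_pos hcl, if_pos hclA, hfil,
      Finset.card_erase_of_mem (by simp [hv, hvu.ne] : v ∈ A.erase u), hc]
    -- There are `m + 1` choices of `w`, each contributing `-m!`.
    obtain ⟨m, hm⟩ : ∃ m, A.card = m + 3 := ⟨A.card - 3, by omega⟩
    rw [hm]
    simp [Nat.factorial_succ]
  · rw [if_neg hcl, if_neg, smul_zero]
    intro h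
    exact hcl (h.subset (by simp))

/-! ### Comparison with connectedness of simple graphs -/

theorem induce_connected_iff {G : SimpleGraph V} {E : Finset (Sym2 V)}
    (hE : ∀ a b, s(a, b) ∈ E ↔ G.Adj a b) {A : Finset V} (hA : A.Nonempty) :
    (G.induce (A : Set V)).Connected ↔ ConnectedOn E A := by
  constructor
  · intro h X hX ⟨a, ha⟩ hc
    refine Finset.Subset.antisymm hX fun b hb => ?_
    have hr := h.preconnected ⟨a, hX ha⟩ ⟨b, hb⟩
    rw [SimpleGraph.reachable_iff_reflTransGen] at hr
    have : ∀ c : (A : Set V), Relation.ReflTransGen (G.induce (A : Set V)).Adj ⟨a, hX ha⟩ c →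
        c.1 ∈ X := by
      intro c hc'
      induction hc' with
      | refl => exact ha
      | tail _ hadj ih => exact hc _ ih _ (Subtype.prop _) ((hE _ _).2 hadj)
    exact this _ hr
  · intro h
    obtain ⟨a, ha⟩ := hA
    have hall : ∀ b (hb : b ∈ A), (G.induce (A : Set V)).Reachable ⟨a, ha⟩ ⟨b, hb⟩ := by
      have hX := h (A.filter fun b => ∃ hb : b ∈ A,
          (G.induce (A : Set V)).Reachable ⟨a, ha⟩ ⟨b, hb⟩) (Finset.filter_subset _ _)
        ⟨a, by simp [ha]⟩ ?_
      · intro b hb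
        have hb' := hb
        rw [← hX] at hb'
        exact (Finset.mem_filter.1 hb').2.2
      · intro c hc b hb hcb
        obtain ⟨-, hcA, hr⟩ := Finset.mem_filter.1 hc
        refine Finset.mem_filter.2 ⟨hb, hb, hr.trans ?_⟩
        exact SimpleGraph.Adj.reachable (show (G.induce (A : Set V)).Adj ⟨c, hcA⟩ ⟨b, hb⟩ from
          (hE _ _).1 hcb)
    have : Nonempty (A : Set V) := ⟨⟨a, ha⟩⟩
    exact SimpleGraph.Connected.mk fun x y => (hall x.1 x.2).symm.trans (hall y.1 y.2)

/-- `Connected` demands a vertex while `ConnectedOn` holds on the empty set; with two vertices no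
deletion empties the graph. -/
theorem isTwoConnected_iff [Fintype V] {G : SimpleGraph V} {E : Finset (Sym2 V)}
    (hE : ∀ a b, s(a, b) ∈ E ↔ G.Adj a b) (hcard : 2 ≤ Fintype.card V) :
    IsTwoConnected G ↔ TwoConnectedOn E Finset.univ := by
  have hne : (Finset.univ : Finset V).Nonempty := Finset.card_pos.1 (by
    rw [Finset.card_univ]; omega)
  refine and_congr ?_ ⟨fun h v _ => ?_, fun h v => ?_⟩
  · rw [← induce_connected_iff hE hne, Finset.coe_univ]
    exact (SimpleGraph.induceUnivIso G).connected_iff.symm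
  all_goals
    have hv : ((Finset.univ.erase v : Finset V) : Set V) = {v}ᶜ := by ext; simp
    have hne' : (Finset.univ.erase v : Finset V).Nonempty := Finset.card_pos.1 (by
      rw [Finset.card_erase_of_mem (Finset.mem_univ v), Finset.card_univ]; omega)
  · rw [← induce_connected_iff hE hne', hv]
    exact h v
  · have := h v (Finset.mem_univ v)
    rwa [← induce_connected_iff hE hne', hv] at this

end Graphs

/-! ### The pointwise identity -/

/-- The graph of the pairs of points at distance less than `1`. -/
def unitDistanceGraph {V : Type*} (p : V → ℝ) : SimpleGraph V where
  Adj i j := i ≠ j ∧ |p i - p j| < 1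
  symm := ⟨fun i j h => ⟨h.1.symm, by rw [abs_sub_comm]; exact h.2⟩⟩
  loopless := ⟨fun _ h => h.1 rfl⟩

/-- The neighbours of a leftmost point all lie within distance less than `1` to its right. -/
theorem hasSimplicialVertices_unitDistanceGraph {V : Type*} (p : V → ℝ) :
    HasSimplicialVertices (unitDistanceGraph p) := by
  intro A hA
  obtain ⟨v, hv, hmin⟩ := A.exists_min_image p hA
  refine ⟨v, hv, fun a ha b hb hva hvb hab => ⟨hab, ?_⟩⟩
  have h1 := abs_lt.1 hva.2
  have h2 := abs_lt.1 hvb.2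
  have h3 := hmin a ha
  have h4 := hmin b hb
  rw [abs_lt]
  constructor <;> linarith

theorem mem_polytope_iff {n : ℕ} {G : SimpleGraph (Fin n)} {x : FreeVertex n → ℝ} :
    x ∈ polytope G ↔ G ≤ unitDistanceGraph (position x) :=
  ⟨fun h i j hij => ⟨hij.ne, h i j hij⟩, fun h _ _ hij => (h hij).2⟩

theorem sum_indicator_polytope {n : ℕ} (hn : 2 ≤ n) (x : FreeVertex n → ℝ) :
    ∑ G ∈ twoConnectedGraphs n,
      (polytope G).indicator (fun _ => (-1 : ℝ) ^ G.edgeSet.ncard) x =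
    (polytope (⊤ : SimpleGraph (Fin n))).indicator
      (fun _ => -((n - 2).factorial : ℝ)) x := by
  classical
  set H := unitDistanceGraph (position x) with hH
  have hsum := twoConnectedSum_eq (hasSimplicialVertices_unitDistanceGraph (position x))
    Finset.univ (by simpa using hn)
  have hcl : H.IsClique (Finset.univ : Finset (Fin n)) ↔
      x ∈ polytope (⊤ : SimpleGraph (Fin n)) := by
    rw [mem_polytope_iff]
    exact ⟨fun h i j hij => h (by simp) (by simp) hij, fun h i _ j _ hij => h hij⟩
  have hR : (polytope (⊤ : SimpleGraph (Fin n))).indicator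
      (fun _ => -((n - 2).factorial : ℝ)) x = (twoConnectedSum H Finset.univ : ℝ) := by
    rw [hsum, Set.indicator_apply]
    simp only [← hH, hcl, Finset.card_univ, Fintype.card_fin]
    split_ifs <;> simp
  -- Both sums are restricted to nonzero terms, where the two-connected `G ≤ H` correspond to their
  -- edge sets.
  rw [hR, twoConnectedSum, Int.cast_sum, ← Finset.sum_filter_ne_zero]
  conv_rhs => rw [← Finset.sum_filter_ne_zero]
  have hcard : ∀ G : SimpleGraph (Fin n), G.edgeSet.ncard = G.edgeFinset.card := fun G => by
    rw [← SimpleGraph.coe_edgeFinset, Set.ncard_coe_finset]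
  have htc : ∀ G : SimpleGraph (Fin n), G ∈ twoConnectedGraphs n ↔
      TwoConnectedOn G.edgeFinset Finset.univ := fun G => by
    rw [twoConnectedGraphs, Finset.mem_filter, isTwoConnected_iff (E := G.edgeFinset)
      (by simp) (by simpa using hn)]
    simp
  have hsub : ∀ G : SimpleGraph (Fin n), G.edgeFinset ⊆ edgesOn H Finset.univ ↔ G ≤ H := by
    intro G
    rw [← SimpleGraph.edgeSet_subset_edgeSet]
    constructor
    · intro h e he
      have := h (SimpleGraph.mem_edgeFinset.2 he)
      simpa [edgesOn] using this
    · intro h e he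
      have := h (SimpleGraph.mem_edgeFinset.1 he)
      simpa [edgesOn] using this
  refine Finset.sum_bij (fun G _ => G.edgeFinset) ?_ ?_ ?_ ?_
  · intro G hG
    simp only [Finset.mem_filter, htc, Set.indicator_apply, mem_polytope_iff, Finset.mem_powerset,
      hsub] at hG ⊢
    obtain ⟨h1, h2⟩ := hG
    have h3 : G ≤ H := by
      by_contra h
      exact h2 (if_neg h)
    exact ⟨h3, by simp [h1]⟩
  · intro G _ G' _ h
    exact SimpleGraph.edgeFinset_inj.1 h
  · intro E hE
    simp only [Finset.mem_filter, Finset.mem_powerset] at hE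
    obtain ⟨h1, h2⟩ := hE
    have h3 : TwoConnectedOn E Finset.univ := by
      by_contra h
      exact h2 (by simp [h])
    obtain ⟨G, hG⟩ : ∃ G : SimpleGraph (Fin n), G.edgeSet = E := by
      refine ⟨SimpleGraph.fromEdgeSet (E : Set (Sym2 (Fin n))), ?_⟩
      rw [SimpleGraph.edgeSet_fromEdgeSet]
      refine Set.Subset.antisymm Set.sdiff_subset fun e he => ⟨he, fun hd => ?_⟩
      have := h1 he
      simp only [edgesOn, Finset.mem_filter] at this
      exact H.not_isDiag_of_mem_edgeSet this.2 hd
    have hEe : G.edgeFinset = E := by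
      ext e
      rw [SimpleGraph.mem_edgeFinset, hG, Finset.mem_coe]
    refine ⟨G, ?_, hEe⟩
    have h4 := (hsub G).1 (by rw [hEe]; exact h1)
    simp only [Finset.mem_filter, htc, hEe]
    refine ⟨h3, ?_⟩
    rw [Set.indicator_of_mem (mem_polytope_iff.2 h4)]
    simp
  · intro G hG
    simp only [Finset.mem_filter, htc] at hG
    have h3 : x ∈ polytope G := by
      by_contra h
      exact hG.2 (Set.indicator_of_notMem h _)
    rw [Set.indicator_of_mem h3, if_pos hG.1, hcard]
    simp

/-! ### Measurability and finite volume -/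

theorem continuous_position {n : ℕ} (i : Fin n) :
    Continuous fun x : FreeVertex n → ℝ => position x i := by
  unfold position
  split_ifs <;> fun_prop

theorem measurableSet_polytope {n : ℕ} (G : SimpleGraph (Fin n)) : MeasurableSet (polytope G) := by
  have : polytope G = ⋂ i, ⋂ j, ⋂ _ : G.Adj i j,
      {x : FreeVertex n → ℝ | |position x i - position x j| < 1} := by
    ext
    simp [polytope]
  rw [this]
  refine MeasurableSet.iInter fun i => MeasurableSet.iInter fun j => MeasurableSet.iInter fun _ =>
    (isOpen_lt ?_ continuous_const).measurableSet
  exact ((continuous_position i).sub (continuous_position j)).abs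

/-- A walk from the origin vertex bounds each coordinate by its length. -/
theorem volume_polytope_ne_top {n : ℕ} {G : SimpleGraph (Fin n)} (hG : G.Connected) :
    volume (polytope G) ≠ ⊤ := by
  have hbound : ∀ i : Fin n, ∃ C : ℝ, ∀ x ∈ polytope G, |position x i| ≤ C := by
    intro i
    have hr := hG.preconnected ⟨0, i.pos⟩ i
    rw [SimpleGraph.reachable_iff_reflTransGen] at hr
    induction hr with
    | refl => exact ⟨0, fun x _ => by simp [position]⟩
    | @tail b c _ hbc ih =>
      obtain ⟨C, hC⟩ := ih
      refine ⟨C + 1, fun x hx => ?_⟩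
      have h1 := hC x hx
      have h2 := hx b c hbc
      have h3 := abs_sub_abs_le_abs_sub (position x c) (position x b)
      rw [abs_sub_comm] at h3
      linarith
  choose C hC using hbound
  have hsub : polytope G ⊆ Set.Icc (fun j : FreeVertex n => -C j.1) (fun j => C j.1) := by
    intro x hx
    have h : ∀ j : FreeVertex n, |x j| ≤ C j.1 := fun j => by
      have := hC j.1 x hx
      rwa [position, dif_pos j.2] at this
    exact ⟨fun j => (abs_le.1 (h j)).1, fun j => (abs_le.1 (h j)).2⟩
  exact measure_ne_top_of_subset hsub isCompact_Icc.measure_lt_top.ne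

/-! ### The volume for the complete graph -/

/-- The vertex other than `k` whose position relative to `k` is the coordinate `j` after moving
the origin to `k`. -/
def recentreVertex {n : ℕ} (k : Fin n) (j : FreeVertex n) : Fin n :=
  if j.1 = k then ⟨0, k.pos⟩ else j.1

/-- The linear map that moves the origin to the vertex `k`, which then changes places with the
first vertex. -/
def recentre {n : ℕ} (k : Fin n) : (FreeVertex n → ℝ) →ₗ[ℝ] (FreeVertex n → ℝ) where
  toFun x j := position x (recentreVertex k j) - position x k
  map_add' x y := by
    ext j
    simp only [position, Pi.add_apply]
    split_ifs <;> ring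
  map_smul' c x := by
    ext j
    simp only [position, Pi.smul_apply, smul_eq_mul, RingHom.id_apply]
    split_ifs <;> ring

theorem recentre_apply {n : ℕ} (k : Fin n) (x : FreeVertex n → ℝ) (j : FreeVertex n) :
    recentre k x j = position x (recentreVertex k j) - position x k := rfl

theorem recentre_comp_recentre {n : ℕ} (k : Fin n) :
    recentre k ∘ₗ recentre k = LinearMap.id := by
  refine LinearMap.ext fun x => funext fun j => ?_
  have hj := j.2
  have hk : position (recentre k x) k = - position x k := by
    by_cases h : k.val = 0
    · simp [position, h]
    · simp [position, h, recentre_apply, recentreVertex]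
  rw [LinearMap.comp_apply, recentre_apply, hk, LinearMap.id_apply]
  by_cases h : j.1 = k
  · subst h
    simp [recentreVertex, position, hj]
  · simp [recentreVertex, position, hj, recentre_apply, h]

/-- An involution has determinant of square `1`. -/
theorem abs_det_recentre {n : ℕ} (k : Fin n) : |LinearMap.det (recentre k)| = 1 := by
  have h := congrArg LinearMap.det (recentre_comp_recentre k)
  rw [LinearMap.det_comp, LinearMap.det_id] at h
  rw [← sq_eq_sq₀ (abs_nonneg _) zero_le_one, sq_abs, one_pow, sq, h]

/-- The configurations of diameter less than `1` whose leftmost vertex is `k`, the smallest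
index among several leftmost ones. -/
def leftmostCell {n : ℕ} (k : Fin n) : Set (FreeVertex n → ℝ) :=
  {x | ∀ i, i ≠ k → position x i - position x k ∈
    if i < k then Set.Ioo (0 : ℝ) 1 else Set.Ico (0 : ℝ) 1}

/-- `recentreVertex k` runs over all vertices except `k`, so recentring turns the cell into a
product of unit intervals. -/
theorem leftmostCell_eq_preimage {n : ℕ} (k : Fin n) :
    leftmostCell k = recentre k ⁻¹' Set.univ.pi fun j =>
      if recentreVertex k j < k then Set.Ioo (0 : ℝ) 1 else Set.Ico (0 : ℝ) 1 := by
  ext x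
  simp only [leftmostCell, Set.mem_ofPred_eq, Set.mem_preimage, Set.mem_univ_pi, recentre_apply]
  constructor
  · intro h j
    apply h
    intro hj
    rw [recentreVertex] at hj
    split_ifs at hj with hjk
    · exact j.2 (by rw [hjk, ← hj])
    · exact hjk hj
  · intro h i hi
    by_cases h0 : i.val = 0
    · have hk : k.val ≠ 0 := fun hk => hi (Fin.ext (h0.trans hk.symm))
      have h1 : recentreVertex k ⟨k, hk⟩ = i := by
        rw [recentreVertex, if_pos rfl]
        exact Fin.ext h0.symm
      have := h ⟨k, hk⟩
      rwa [h1] at this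
    · have h1 : recentreVertex k ⟨i, h0⟩ = i := by
        rw [recentreVertex, if_neg hi]
      have := h ⟨i, h0⟩
      rwa [h1] at this

theorem volume_leftmostCell {n : ℕ} (k : Fin n) : volume (leftmostCell k) = 1 := by
  have hdet : LinearMap.det (recentre k) ≠ 0 := fun h => by
    have := abs_det_recentre k
    simp [h] at this
  rw [leftmostCell_eq_preimage, Measure.addHaar_preimage_linearMap _ hdet, abs_inv,
    abs_det_recentre, volume_pi_pi, Finset.prod_eq_one]
  · simp
  · intro j _
    split_ifs <;> simp

theorem measurableSet_leftmostCell {n : ℕ} (k : Fin n) : MeasurableSet (leftmostCell k) := by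
  rw [leftmostCell_eq_preimage]
  refine (recentre k).continuous_of_finiteDimensional.measurable
    (MeasurableSet.univ_pi fun j => ?_)
  split_ifs
  · exact measurableSet_Ioo
  · exact measurableSet_Ico

theorem polytope_top_eq_iUnion {n : ℕ} (hn : 0 < n) :
    polytope (⊤ : SimpleGraph (Fin n)) = ⋃ k, leftmostCell k := by
  ext x
  rw [Set.mem_iUnion]
  constructor
  · intro hx
    have : Nonempty (Fin n) := ⟨⟨0, hn⟩⟩
    -- The lexicographic minimum breaks ties by index, matching the open intervals for `i < k`.
    obtain ⟨k, hk⟩ := Finite.exists_min fun i : Fin n => toLex (position x i, i)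
    refine ⟨k, fun i hi => ?_⟩
    have h1 := abs_lt.1 (hx i k (by simpa using hi))
    have h2 := hk i
    rw [Prod.Lex.le_iff] at h2
    simp only [ofLex_toLex] at h2
    split_ifs with hik
    · refine ⟨?_, h1.2⟩
      rcases h2 with h2 | h2
      · linarith
      · exact absurd h2.2 (not_le.2 hik)
    · refine ⟨?_, h1.2⟩
      rcases h2 with h2 | h2
      · linarith
      · linarith [h2.1]
  · rintro ⟨k, hk⟩
    have h : ∀ i, 0 ≤ position x i - position x k ∧ position x i - position x k < 1 := by
      intro i
      by_cases hi : i = k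
      · simp [hi]
      · have := hk i hi
        split_ifs at this
        · exact ⟨this.1.le, this.2⟩
        · exact this
    intro i j _
    have h1 := h i
    have h2 := h j
    rw [abs_lt]
    constructor <;> linarith

theorem pairwise_disjoint_leftmostCell (n : ℕ) :
    Pairwise (Function.onFun Disjoint (leftmostCell (n := n))) := by
  have key : ∀ k l : Fin n, k < l → Disjoint (leftmostCell k) (leftmostCell l) := by
    intro k l hkl
    rw [Set.disjoint_left]
    intro x hk hl
    have h1 := hl k hkl.ne
    have h2 := hk l hkl.ne'
    rw [if_pos hkl] at h1
    rw [if_neg (not_lt.2 hkl.le)] at h2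
    linarith [h1.1, h2.1]
  intro k l hkl
  rcases lt_or_gt_of_ne hkl with h | h
  · exact key k l h
  · exact (key l k h).symm

theorem volume_polytope_top {n : ℕ} (hn : 0 < n) :
    volume (polytope (⊤ : SimpleGraph (Fin n))) = n := by
  rw [polytope_top_eq_iUnion hn, measure_iUnion (pairwise_disjoint_leftmostCell n)
    measurableSet_leftmostCell, tsum_fintype]
  simp [volume_leftmostCell]

end TonksGas

/-! ### Integration of the pointwise identity -/

theorem theorem2 (n : ℕ) (hn : 2 ≤ n) :
    (∀ G ∈ TonksGas.twoConnectedGraphs n,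
      MeasureTheory.volume (TonksGas.polytope G) ≠ ⊤) ∧
    ∑ G ∈ TonksGas.twoConnectedGraphs n,
      (-1 : ℝ) ^ G.edgeSet.ncard * (MeasureTheory.volume (TonksGas.polytope G)).toReal
      = -((n : ℝ) * (Nat.factorial (n - 2) : ℝ)) := by
  have hfin : ∀ G ∈ TonksGas.twoConnectedGraphs n, volume (TonksGas.polytope G) ≠ ⊤ :=
    fun G hG => TonksGas.volume_polytope_ne_top (by
      classical
      exact (Finset.mem_filter.1 hG).2.1)
  refine ⟨hfin, ?_⟩
  have hint := congrArg (fun f : (TonksGas.FreeVertex n → ℝ) → ℝ => ∫ x, f x)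
    (funext (TonksGas.sum_indicator_polytope hn))
  rw [integral_finsetSum, integral_indicator_const _ (TonksGas.measurableSet_polytope _),
    Measure.real, TonksGas.volume_polytope_top (by omega)] at hint
  · rw [← mul_neg]
    refine Eq.trans (Finset.sum_congr rfl fun G _ => ?_) (hint.trans (by simp))
    rw [integral_indicator_const _ (TonksGas.measurableSet_polytope _), smul_eq_mul, mul_comm]
    rfl
  · intro G hG
    exact (integrable_indicator_iff (TonksGas.measurableSet_polytope _)).2
      (integrableOn_const (hfin G hG))

end
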